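/- Let $(\Omega,\mathcal{A},\mu)$ be a complete $\sigma$-finite measure space with $\mu(\Omega)>0$, and let $M\colon\Omega\rightrightarrows\mathbb{R}^n$ be a multifunction that is measurable, i.e. $\{\omega\in\Omega : M(\omega)\cap U\neq\emptyset\}\in\mathcal{A}$ for every open $U\subset\mathbb{R}^n$, and all of whose values $M(\omega)$ are closed cones (a cone is a set that contains $0$ and is stable under multiplication by positive scalars). Put $$M_\cap:=\{x\in\mathbb{R}^n : x\in M(\omega)\text{ for a.e. }\omega\in\Omega\}.$$ For $\Theta\subset\mathbb{R}^n$ and $\bar x\in\Theta$, the regular normal cone is $$\widehat N(\bar x;\Theta):=\Big\{x^*\in\mathbb{R}^n : \limsup_{x\to\bar x,\ x\in\Theta,\ x\ne\bar x}\frac{\langle x^*,x-\bar x\rangle}{\|x-\bar x\|}\le 0\Big\}$$ (the upper limit being $-\infty$ if $\bar x$ is isolated in $\Theta$), and the limiting normal cone $N(\bar x;\Theta)$ is the set of all limits $\lim_k x_k^*$ with $x_k^*\in\widehat N(x_k;\Theta)$, $x_k\in\Theta$ and $x_k\to\bar x$. The set $\Theta$ is normally regular at $\bar x\in\Theta$ if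 $\widehat N(\bar x;\Theta)=N(\bar x;\Theta)$. For $F\colon\Omega\rightrightarrows\mathbb{R}^n$, the (Aumann) integral $\int_\Omega F(\omega)\,d\mu(\omega)$ is the set of all $\int_\Omega f\,d\mu$ with $f\in L^1(\Omega,\mathbb{R}^n)$ and $f(\omega)\in F(\omega)$ for a.e. $\omega$. Assume that $M(\omega)$ is normally regular at $0$ for a.e. $\omega\in\Omega$. Then $M_\cap$ is normally regular at $0$, and $$N(0;M_\cap)=\operatorname{cl}\Big(\int_\Omega N(0;M(\omega))\,d\mu(\omega)\Big),\qquad \operatorname{ri}\big(N(0;M_\cap)\big)=\operatorname{ri}\Big(\int_\Omega N(0;M(\omega))\,d\mu(\omega)\Big),$$ where $\operatorname{cl}$ denotes the closure and $\operatorname{ri}$ the relative interior (the interior relative to the affine hull). -/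

import Mathlib

open Filter Topology MeasureTheory

/-- Regular (Fréchet) normal cone to `Θ` at `x`: the vectors `v` such that the upper limit, as
`y → x` with `y ∈ Θ` and `y ≠ x`, of `⟪v, y - x⟫ / ‖y - x‖` is at most `0`. The upper limit is
taken in the extended reals, so that it is `-∞` when `x` is isolated in `Θ`. -/
noncomputable def regularNormalCone {n : ℕ} (x : EuclideanSpace ℝ (Fin n))
    (Θ : Set (EuclideanSpace ℝ (Fin n))) : Set (EuclideanSpace ℝ (Fin n)) :=
  {v | limsup (fun y => ((inner ℝ v (y - x) / ‖y - x‖ : ℝ) : EReal)) (𝓝[Θ \ {x}] x) ≤ 0}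

/-- Basic (limiting, Mordukhovich) normal cone to `Θ` at `x`: the outer limit of the regular
normal cones to `Θ` at `y` as `y → x` with `y ∈ Θ`. -/
def limitingNormalCone {n : ℕ} (x : EuclideanSpace ℝ (Fin n))
    (Θ : Set (EuclideanSpace ℝ (Fin n))) : Set (EuclideanSpace ℝ (Fin n)) :=
  {v | ∃ y w : ℕ → EuclideanSpace ℝ (Fin n),
    (∀ k, y k ∈ Θ) ∧ Tendsto y atTop (𝓝 x) ∧
    (∀ k, w k ∈ regularNormalCone (y k) Θ) ∧ Tendsto w atTop (𝓝 v)}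

/-- `Θ` is normally regular at `x ∈ Θ`. -/
def NormallyRegularAt {n : ℕ} (Θ : Set (EuclideanSpace ℝ (Fin n)))
    (x : EuclideanSpace ℝ (Fin n)) : Prop :=
  x ∈ Θ ∧ regularNormalCone x Θ = limitingNormalCone x Θ

/-- `K` is a cone: it contains the origin and is stable under positive scaling. -/
def IsConeSet {n : ℕ} (K : Set (EuclideanSpace ℝ (Fin n))) : Prop :=
  0 ∈ K ∧ ∀ t : ℝ, 0 < t → ∀ x ∈ K, t • x ∈ K

/-- Measurability of a multifunction: preimages of open sets are measurable. -/
def MeasurableMultifunction {Ω : Type*} [MeasurableSpace Ω] {n : ℕ}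
    (M : Ω → Set (EuclideanSpace ℝ (Fin n))) : Prop :=
  ∀ U : Set (EuclideanSpace ℝ (Fin n)), IsOpen U → MeasurableSet {ω | (M ω ∩ U).Nonempty}

/-- The essential intersection of a multifunction. -/
def essInter {Ω : Type*} [MeasurableSpace Ω] (μ : Measure Ω) {n : ℕ}
    (M : Ω → Set (EuclideanSpace ℝ (Fin n))) : Set (EuclideanSpace ℝ (Fin n)) :=
  {x | ∀ᵐ ω ∂μ, x ∈ M ω}

/-- The Aumann integral of a multifunction: the set of integrals of its integrable selections. -/
noncomputable def aumannIntegral {Ω : Type*} [MeasurableSpace Ω] (μ : Measure Ω) {n : ℕ}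
    (F : Ω → Set (EuclideanSpace ℝ (Fin n))) : Set (EuclideanSpace ℝ (Fin n)) :=
  {v | ∃ f : Ω → EuclideanSpace ℝ (Fin n),
    Integrable f μ ∧ (∀ᵐ ω ∂μ, f ω ∈ F ω) ∧ ∫ ω, f ω ∂μ = v}

open scoped InnerProductSpace

/-! For a closed cone `K` regular at `0`, all limiting normals at `0` lie in the polar cone. If `p`
is a nearest point of `K` to `z`, scaling `p` down to `0` shows that `z - p` is such a normal. This
yields a Moreau decomposition (`IsConeSet.exists_moreau`) and forces `K` to be convex. Hence almost
all `M ω` are convex, so is the essential intersection, and its two normal cones at `0` equal its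
polar.

It remains to compare this polar with the integral `A` of the polars, a convex cone. Integrating
inner products gives `A ⊆ polarCone (essInter μ M)`. Conversely, a point of `polarCone A`, tested
against its own weighted projection residuals, lies in almost every `M ω`
(`polarCone_aumannIntegral_subset`). The bipolar theorem then gives equality up to closure, and a
convex set has the relative interior of its closure. -/

/-- The polar cone of a set. -/
def polarCone {n : ℕ} (K : Set (EuclideanSpace ℝ (Fin n))) : Set (EuclideanSpace ℝ (Fin n)) :=
  {v | ∀ y ∈ K, ⟪v, y⟫_ℝ ≤ 0}

theorem mem_polarCone {n : ℕ} {K : Set (EuclideanSpace ℝ (Fin n))}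
    {v : EuclideanSpace ℝ (Fin n)} : v ∈ polarCone K ↔ ∀ y ∈ K, ⟪v, y⟫_ℝ ≤ 0 := Iff.rfl

theorem mem_essInter {Ω : Type*} [MeasurableSpace Ω] {μ : Measure Ω} {n : ℕ}
    {M : Ω → Set (EuclideanSpace ℝ (Fin n))} {x : EuclideanSpace ℝ (Fin n)} :
    x ∈ essInter μ M ↔ ∀ᵐ ω ∂μ, x ∈ M ω := Iff.rfl

/-! ### Normal cones of star-shaped and convex sets -/

theorem mem_regularNormalCone_of_le_sq {n : ℕ} {Θ : Set (EuclideanSpace ℝ (Fin n))}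
    {x v : EuclideanSpace ℝ (Fin n)} (C : ℝ)
    (h : ∀ y ∈ Θ, ⟪v, y - x⟫_ℝ ≤ C * ‖y - x‖ ^ 2) : v ∈ regularNormalCone x Θ := by
  have hlim : Tendsto (fun y => ((C * ‖y - x‖ : ℝ) : EReal)) (𝓝[Θ \ {x}] x) (𝓝 0) := by
    have hc : Continuous fun y : EuclideanSpace ℝ (Fin n) => ((C * ‖y - x‖ : ℝ) : EReal) :=
      continuous_coe_real_ereal.comp (by fun_prop)
    have := (hc.tendsto x).mono_left (nhdsWithin_le_nhds (s := Θ \ {x}))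
    simpa using this
  have hle : ∀ᶠ y in 𝓝[Θ \ {x}] x,
      ((⟪v, y - x⟫_ℝ / ‖y - x‖ : ℝ) : EReal) ≤ ((C * ‖y - x‖ : ℝ) : EReal) := by
    filter_upwards [self_mem_nhdsWithin] with y hy
    have hpos : 0 < ‖y - x‖ := norm_pos_iff.2 (sub_ne_zero.2 hy.2)
    rw [EReal.coe_le_coe_iff, div_le_iff₀ hpos]
    nlinarith [h y hy.1]
  rcases eq_or_neBot (𝓝[Θ \ {x}] x) with hb | hb
  · simp [regularNormalCone, hb]
  · exact (limsup_le_limsup hle).trans hlim.limsup_eq.le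

/-- The quotient is constant along the segment from `x` to `y`, so its value there is bounded by the
upper limit. -/
theorem inner_sub_le_zero_of_mem_regularNormalCone {n : ℕ} {Θ : Set (EuclideanSpace ℝ (Fin n))}
    {x v y : EuclideanSpace ℝ (Fin n)} (hΘ : StarConvex ℝ x Θ)
    (hv : v ∈ regularNormalCone x Θ) (hy : y ∈ Θ) : ⟪v, y - x⟫_ℝ ≤ 0 := by
  rcases eq_or_ne y x with rfl | hne
  · simp
  have hpos : 0 < ‖y - x‖ := norm_pos_iff.2 (sub_ne_zero.2 hne)
  have htend : Tendsto (fun t : ℝ => x + t • (y - x)) (𝓝[>] 0) (𝓝[Θ \ {x}] x) := by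
    refine tendsto_nhdsWithin_iff.2 ⟨?_, ?_⟩
    · have hc : Continuous fun t : ℝ => x + t • (y - x) := by fun_prop
      simpa using (hc.tendsto 0).mono_left nhdsWithin_le_nhds
    · filter_upwards [Ioc_mem_nhdsGT (zero_lt_one (α := ℝ))] with t ht
      refine ⟨hΘ.add_smul_sub_mem hy ht.1.le ht.2, ?_⟩
      simp [ht.1.ne', sub_ne_zero.2 hne]
  have hfreq : ∃ᶠ z in 𝓝[Θ \ {x}] x,
      ((⟪v, y - x⟫_ℝ / ‖y - x‖ : ℝ) : EReal) ≤ ((⟪v, z - x⟫_ℝ / ‖z - x‖ : ℝ) : EReal) := by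
    refine htend.frequently (Eventually.frequently ?_)
    filter_upwards [self_mem_nhdsWithin] with t ht
    have ht : 0 < t := ht
    rw [add_sub_cancel_left, inner_smul_right, norm_smul, Real.norm_of_nonneg ht.le,
      mul_div_mul_left _ _ ht.ne']
  have h := (le_limsup_of_frequently_le hfreq).trans hv
  rw [← EReal.coe_zero, EReal.coe_le_coe_iff, div_le_iff₀ hpos, zero_mul] at h
  exact h

theorem IsConeSet.starConvex {n : ℕ} {K : Set (EuclideanSpace ℝ (Fin n))} (hK : IsConeSet K) :
    StarConvex ℝ 0 K := by
  refine starConvex_zero_iff.2 fun x hx a ha _ => ?_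
  rcases ha.eq_or_lt with rfl | ha
  · simpa using hK.1
  · exact hK.2 a ha x hx

theorem IsConeSet.regularNormalCone_zero {n : ℕ} {K : Set (EuclideanSpace ℝ (Fin n))}
    (hK : IsConeSet K) : regularNormalCone 0 K = polarCone K := by
  ext v
  refine ⟨fun hv => mem_polarCone.2 fun y hy => ?_, fun hv => mem_regularNormalCone_of_le_sq 0 fun y hy => ?_⟩
  · simpa using inner_sub_le_zero_of_mem_regularNormalCone hK.starConvex hv hy
  · simpa using hv y hy

theorem IsConeSet.limitingNormalCone_zero_of_convex {n : ℕ} {K : Set (EuclideanSpace ℝ (Fin n))}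
    (hK : IsConeSet K) (hconv : Convex ℝ K) : limitingNormalCone 0 K = polarCone K := by
  apply Set.Subset.antisymm
  · rintro v ⟨y, w, hy, hy0, hw, hwv⟩ z hz
    have hlim : Tendsto (fun k => ⟪w k, z - y k⟫_ℝ) atTop (𝓝 ⟪v, z - 0⟫_ℝ) :=
      hwv.inner (tendsto_const_nhds.sub hy0)
    rw [sub_zero] at hlim
    exact le_of_tendsto' hlim fun k =>
      inner_sub_le_zero_of_mem_regularNormalCone (hconv (hy k)) (hw k) hz
  · rw [← hK.regularNormalCone_zero]
    exact fun v hv => ⟨fun _ => 0, fun _ => v, fun _ => hK.1, tendsto_const_nhds, fun _ => hv,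
      tendsto_const_nhds⟩

theorem IsConeSet.limitingNormalCone_zero_of_regular {n : ℕ}
    {K : Set (EuclideanSpace ℝ (Fin n))} (hK : IsConeSet K) (hreg : NormallyRegularAt K 0) :
    limitingNormalCone 0 K = polarCone K := by
  rw [← hreg.2, hK.regularNormalCone_zero]

/-! ### Metric projection onto closed cones -/

theorem IsConeSet.inner_sub_nonneg_of_isMinOn {n : ℕ} {K : Set (EuclideanSpace ℝ (Fin n))}
    (hK : IsConeSet K) {z p : EuclideanSpace ℝ (Fin n)} (hp : p ∈ K)
    (hmin : ∀ y ∈ K, ‖z - p‖ ≤ ‖z - y‖) : 0 ≤ ⟪z - p, p⟫_ℝ := by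
  have key : ∀ t : ℝ, 0 < t → t < 1 → 0 ≤ 2 * ⟪z - p, p⟫_ℝ + t * ‖p‖ ^ 2 := by
    intro t ht ht1
    have h := hmin _ (hK.2 (1 - t) (by linarith) p hp)
    have e : z - (1 - t) • p = (z - p) + t • p := by module
    have h2 : ‖z - p‖ ^ 2 ≤ ‖z - (1 - t) • p‖ ^ 2 := by gcongr
    rw [e, norm_add_sq_real, inner_smul_right, norm_smul, mul_pow, Real.norm_eq_abs, sq_abs] at h2
    have h3 : 0 ≤ t * (2 * ⟪z - p, p⟫_ℝ + t * ‖p‖ ^ 2) := by nlinarith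
    exact nonneg_of_mul_nonneg_right h3 ht
  have hlim : Tendsto (fun t : ℝ => 2 * ⟪z - p, p⟫_ℝ + t * ‖p‖ ^ 2) (𝓝[>] 0)
      (𝓝 (2 * ⟪z - p, p⟫_ℝ)) := by
    have hc : Continuous fun t : ℝ => 2 * ⟪z - p, p⟫_ℝ + t * ‖p‖ ^ 2 := by fun_prop
    simpa using (hc.tendsto 0).mono_left nhdsWithin_le_nhds
  have := ge_of_tendsto hlim (by
    filter_upwards [Ioo_mem_nhdsGT (zero_lt_one (α := ℝ))] with t ht using key t ht.1 ht.2)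
  linarith

/-- The residual of a metric projection onto a closed cone is a limiting normal at the origin. -/
theorem IsConeSet.sub_mem_limitingNormalCone_of_isMinOn {n : ℕ}
    {K : Set (EuclideanSpace ℝ (Fin n))}
    (hK : IsConeSet K) {z p : EuclideanSpace ℝ (Fin n)} (hp : p ∈ K)
    (hmin : ∀ y ∈ K, ‖z - p‖ ≤ ‖z - y‖) : z - p ∈ limitingNormalCone 0 K := by
  have hquad : ∀ y ∈ K, ⟪z - p, y - p⟫_ℝ ≤ 1 / 2 * ‖y - p‖ ^ 2 := by
    intro y hy
    have h2 : ‖z - p‖ ^ 2 ≤ ‖z - y‖ ^ 2 := by gcongr; exact hmin y hy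
    rw [show z - y = (z - p) - (y - p) by abel, norm_sub_sq_real (z - p)] at h2
    linarith
  have hpos : ∀ k : ℕ, 0 < (1 / ((k : ℝ) + 1)) := fun k => Nat.one_div_pos_of_nat
  refine ⟨fun k => (1 / ((k : ℝ) + 1)) • p, fun _ => z - p, fun k => hK.2 _ (hpos k) p hp, ?_,
    fun k => ?_, tendsto_const_nhds⟩
  · simpa using (tendsto_one_div_add_atTop_nhds_zero_nat (𝕜 := ℝ)).smul_const p
  · set t := 1 / ((k : ℝ) + 1) with ht
    have ht0 : 0 < t := hpos k
    -- Dilation by `t` carries the proximal inequality at `p` to `t • p`, dividing its constant by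
    -- `t`.
    refine mem_regularNormalCone_of_le_sq (1 / 2 * t⁻¹) fun y hy => ?_
    have e : y - t • p = t • (t⁻¹ • y - p) := by
      rw [smul_sub, smul_smul, mul_inv_cancel₀ ht0.ne', one_smul]
    have h := hquad _ (hK.2 t⁻¹ (inv_pos.2 ht0) y hy)
    rw [e, inner_smul_right, norm_smul, mul_pow, Real.norm_eq_abs, sq_abs]
    calc t * ⟪z - p, t⁻¹ • y - p⟫_ℝ ≤ t * (1 / 2 * ‖t⁻¹ • y - p‖ ^ 2) := by gcongr
      _ = _ := by field_simp

theorem convex_polarCone {n : ℕ} (K : Set (EuclideanSpace ℝ (Fin n))) :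
    Convex ℝ (polarCone K) := by
  intro v hv w hw a b ha hb _ y hy
  rw [inner_add_left, real_inner_smul_left, real_inner_smul_left]
  nlinarith [mul_nonpos_of_nonneg_of_nonpos ha (hv y hy),
    mul_nonpos_of_nonneg_of_nonpos hb (hw y hy)]

theorem isClosed_polarCone {n : ℕ} (K : Set (EuclideanSpace ℝ (Fin n))) :
    IsClosed (polarCone K) := by
  simp only [polarCone, Set.ofPred_forall]
  exact isClosed_biInter fun y _ => isClosed_le (by fun_prop) continuous_const

theorem isConeSet_polarCone {n : ℕ} (K : Set (EuclideanSpace ℝ (Fin n))) :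
    IsConeSet (polarCone K) := by
  refine ⟨mem_polarCone.2 fun y _ => by simp, fun t ht v hv => mem_polarCone.2 fun y hy => ?_⟩
  rw [real_inner_smul_left]
  exact mul_nonpos_of_nonneg_of_nonpos ht.le (hv y hy)

/-- Metric projection onto a closed cone that is normally regular at the origin: a point splits
into a sum of orthogonal elements of the cone and of its polar. -/
theorem IsConeSet.exists_moreau {n : ℕ} {K : Set (EuclideanSpace ℝ (Fin n))} (hK : IsConeSet K)
    (hclosed : IsClosed K) (hreg : NormallyRegularAt K 0) (z : EuclideanSpace ℝ (Fin n)) :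
    ∃ p ∈ K, Metric.infDist z K = ‖z - p‖ ∧ z - p ∈ polarCone K ∧ ⟪z - p, p⟫_ℝ = 0 := by
  obtain ⟨p, hp, hd⟩ := hclosed.exists_infDist_eq_dist ⟨0, hK.1⟩ z
  rw [dist_eq_norm] at hd
  have hmin : ∀ y ∈ K, ‖z - p‖ ≤ ‖z - y‖ := fun y hy => by
    rw [← hd, ← dist_eq_norm]
    exact Metric.infDist_le_dist_of_mem hy
  have hpol : z - p ∈ polarCone K := by
    rw [← hK.limitingNormalCone_zero_of_regular hreg]
    exact hK.sub_mem_limitingNormalCone_of_isMinOn hp hmin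
  exact ⟨p, hp, hd, hpol, le_antisymm (hpol p hp) (hK.inner_sub_nonneg_of_isMinOn hp hmin)⟩

/-- The residual of a combination of `x` and `y` has nonpositive product with both, and is
orthogonal to its projection; so its norm vanishes. -/
theorem IsConeSet.convex_of_normallyRegularAt {n : ℕ} {K : Set (EuclideanSpace ℝ (Fin n))}
    (hK : IsConeSet K) (hclosed : IsClosed K) (hreg : NormallyRegularAt K 0) : Convex ℝ K := by
  intro x hx y hy a b ha hb _
  obtain ⟨p, hp, -, hpol, horth⟩ := hK.exists_moreau hclosed hreg (a • x + b • y)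
  set z := a • x + b • y
  have hz : ⟪z - p, z⟫_ℝ ≤ 0 := by
    have : ⟪z - p, z⟫_ℝ = a * ⟪z - p, x⟫_ℝ + b * ⟪z - p, y⟫_ℝ := by
      rw [← real_inner_smul_right, ← real_inner_smul_right, ← inner_add_right]
    rw [this]
    nlinarith [mul_nonpos_of_nonneg_of_nonpos ha (hpol x hx),
      mul_nonpos_of_nonneg_of_nonpos hb (hpol y hy)]
  have h0 : ⟪z - p, z - p⟫_ℝ ≤ 0 := by
    rw [inner_sub_right _ z p]; linarith
  rw [real_inner_self_eq_norm_sq] at h0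
  have h1 : z - p = 0 := norm_eq_zero.1 (pow_eq_zero_iff two_ne_zero |>.1
    (le_antisymm h0 (sq_nonneg _)))
  rwa [sub_eq_zero.1 h1]

/-- Twice the residual of the projection is the gradient of the squared distance. -/
theorem IsConeSet.abs_infDist_sq_sub_le {n : ℕ} {K : Set (EuclideanSpace ℝ (Fin n))}
    (hK : IsConeSet K) (hclosed : IsClosed K) (hreg : NormallyRegularAt K 0)
    {z p h : EuclideanSpace ℝ (Fin n)} (hp : p ∈ K) (hd : Metric.infDist z K = ‖z - p‖)
    (hpol : z - p ∈ polarCone K) (horth : ⟪z - p, p⟫_ℝ = 0) :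
    |Metric.infDist (z + h) K ^ 2 - Metric.infDist z K ^ 2 - 2 * ⟪h, z - p⟫_ℝ| ≤ ‖h‖ ^ 2 := by
  obtain ⟨q, hq, hdq, -, -⟩ := hK.exists_moreau hclosed hreg (z + h)
  have hup : Metric.infDist (z + h) K ^ 2 ≤ ‖z - p‖ ^ 2 + 2 * ⟪h, z - p⟫_ℝ + ‖h‖ ^ 2 := by
    have h1 : Metric.infDist (z + h) K ≤ ‖(z - p) + h‖ := by
      have := Metric.infDist_le_dist_of_mem (x := z + h) hp
      rwa [dist_eq_norm, add_sub_right_comm] at this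
    calc Metric.infDist (z + h) K ^ 2 ≤ ‖(z - p) + h‖ ^ 2 := by
          gcongr; exact Metric.infDist_nonneg
      _ = _ := by rw [norm_add_sq_real, real_inner_comm]
  -- Expand the square of the difference of residuals; `q ∈ K` and `z - p` polar fix the sign of the
  -- cross term.
  have hlow : ‖z - p‖ ^ 2 + 2 * ⟪h, z - p⟫_ℝ ≤ ‖z + h - q‖ ^ 2 := by
    have h1 : (0 : ℝ) ≤ ‖(z + h - q) - (z - p)‖ ^ 2 := by positivity
    rw [norm_sub_sq_real] at h1
    have h2 : ⟪z + h - q, z - p⟫_ℝ = ‖z - p‖ ^ 2 + ⟪h, z - p⟫_ℝ + ⟪z - p, p⟫_ℝ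
        - ⟪z - p, q⟫_ℝ := by
      rw [← real_inner_self_eq_norm_sq, real_inner_comm p, real_inner_comm q]
      simp only [inner_add_left, inner_sub_left, inner_sub_right]
      ring
    have h3 := hpol q hq
    linarith
  rw [hd, abs_le]
  rw [hdq] at hup ⊢
  constructor
  · nlinarith [sq_nonneg ‖h‖]
  · linarith

/-! ### Measurability of distances and residuals -/

theorem MeasurableMultifunction.measurable_infDist {Ω : Type*} [MeasurableSpace Ω] {n : ℕ}
    {M : Ω → Set (EuclideanSpace ℝ (Fin n))} (hM : MeasurableMultifunction M)
    (hne : ∀ ω, (M ω).Nonempty) (x : EuclideanSpace ℝ (Fin n)) :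
    Measurable fun ω => Metric.infDist x (M ω) := by
  refine measurable_of_Iio fun r => ?_
  convert hM (Metric.ball x r) Metric.isOpen_ball using 1
  ext ω
  simp only [Set.mem_preimage, Set.mem_Iio, Metric.infDist_lt_iff (hne ω), Set.mem_ofPred_eq,
    Set.Nonempty, Set.mem_inter_iff, Metric.mem_ball, dist_comm]

/-- Measurability of the projection residual. -/
theorem aestronglyMeasurable_residual {Ω : Type*} [MeasurableSpace Ω] {μ : Measure Ω} {n : ℕ}
    {M : Ω → Set (EuclideanSpace ℝ (Fin n))} (hM : MeasurableMultifunction M)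
    (hclosed : ∀ ω, IsClosed (M ω)) (hcone : ∀ ω, IsConeSet (M ω))
    (hreg : ∀ᵐ ω ∂μ, NormallyRegularAt (M ω) 0) (x : EuclideanSpace ℝ (Fin n))
    {p : Ω → EuclideanSpace ℝ (Fin n)}
    (hp : ∀ᵐ ω ∂μ, p ω ∈ M ω ∧ Metric.infDist x (M ω) = ‖x - p ω‖ ∧
      x - p ω ∈ polarCone (M ω) ∧ ⟪x - p ω, p ω⟫_ℝ = 0) :
    AEStronglyMeasurable (fun ω => x - p ω) μ := by
  have hinner : ∀ e : EuclideanSpace ℝ (Fin n), AEMeasurable (fun ω => ⟪e, x - p ω⟫_ℝ) μ := by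
    intro e
    have hmeas := hM.measurable_infDist fun ω => ⟨0, (hcone ω).1⟩
    -- Each component of the residual is a limit of difference quotients of half the squared
    -- distance.
    refine aemeasurable_of_tendsto_metrizable_ae atTop
      (f := fun (k : ℕ) ω => ((k : ℝ) + 1) / 2 *
        (Metric.infDist (x + (1 / ((k : ℝ) + 1)) • e) (M ω) ^ 2 - Metric.infDist x (M ω) ^ 2))
      (fun k => ((((hmeas _).pow_const 2).sub ((hmeas _).pow_const 2)).const_mul _).aemeasurable) ?_
    filter_upwards [hreg, hp] with ω hω ⟨h1, h2, h3, h4⟩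
    rw [tendsto_iff_norm_sub_tendsto_zero]
    have hlim : Tendsto (fun k : ℕ => 1 / ((k : ℝ) + 1) * (‖e‖ ^ 2 / 2)) atTop (𝓝 0) := by
      simpa using (tendsto_one_div_add_atTop_nhds_zero_nat (𝕜 := ℝ)).mul_const (‖e‖ ^ 2 / 2)
    refine squeeze_zero (fun _ => norm_nonneg _) (fun k => ?_) hlim
    have hk : (0 : ℝ) < (k : ℝ) + 1 := by positivity
    have key := (hcone ω).abs_infDist_sq_sub_le (hclosed ω) hω
      (h := (1 / ((k : ℝ) + 1)) • e) h1 h2 h3 h4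
    rw [real_inner_smul_left, norm_smul, mul_pow, Real.norm_eq_abs, sq_abs] at key
    set A := Metric.infDist (x + (1 / ((k : ℝ) + 1)) • e) (M ω) ^ 2 - Metric.infDist x (M ω) ^ 2
    have e1 : ((k : ℝ) + 1) / 2 * A - ⟪e, x - p ω⟫_ℝ
        = ((k : ℝ) + 1) / 2 * (A - 2 * (1 / ((k : ℝ) + 1) * ⟪e, x - p ω⟫_ℝ)) := by
      field_simp
    rw [e1, Real.norm_eq_abs, abs_mul, abs_of_pos (by positivity)]
    calc _ ≤ ((k : ℝ) + 1) / 2 * ((1 / ((k : ℝ) + 1)) ^ 2 * ‖e‖ ^ 2) := by gcongr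
      _ = _ := by field_simp
  have hsum : (fun ω => x - p ω) = fun ω => ∑ i,
      ⟪EuclideanSpace.basisFun (Fin n) ℝ i, x - p ω⟫_ℝ • EuclideanSpace.basisFun (Fin n) ℝ i := by
    funext ω
    exact ((EuclideanSpace.basisFun (Fin n) ℝ).sum_repr' _).symm
  rw [hsum]
  exact Finset.aestronglyMeasurable_fun_sum _ fun i _ =>
    (hinner _).aestronglyMeasurable.smul_const _

/-! ### Essential intersections and Aumann integrals -/

theorem isConeSet_essInter {Ω : Type*} [MeasurableSpace Ω] {μ : Measure Ω} {n : ℕ}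
    {M : Ω → Set (EuclideanSpace ℝ (Fin n))} (hcone : ∀ ω, IsConeSet (M ω)) :
    IsConeSet (essInter μ M) := by
  refine ⟨mem_essInter.2 (Eventually.of_forall fun ω => (hcone ω).1), fun t ht x hx => ?_⟩
  have hx : ∀ᵐ ω ∂μ, x ∈ M ω := hx
  exact hx.mono fun ω h => (hcone ω).2 t ht x h

theorem convex_essInter {Ω : Type*} [MeasurableSpace Ω] {μ : Measure Ω} {n : ℕ}
    {M : Ω → Set (EuclideanSpace ℝ (Fin n))} (hconv : ∀ᵐ ω ∂μ, Convex ℝ (M ω)) :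
    Convex ℝ (essInter μ M) := by
  intro x hx y hy a b ha hb hab
  have hx : ∀ᵐ ω ∂μ, x ∈ M ω := hx
  have hy : ∀ᵐ ω ∂μ, y ∈ M ω := hy
  filter_upwards [hconv, hx, hy] with ω h h1 h2 using h h1 h2 ha hb hab

theorem aumannIntegral_congr_ae {Ω : Type*} [MeasurableSpace Ω] {μ : Measure Ω} {n : ℕ}
    {F G : Ω → Set (EuclideanSpace ℝ (Fin n))} (h : ∀ᵐ ω ∂μ, F ω = G ω) :
    aumannIntegral μ F = aumannIntegral μ G := by
  ext v
  refine exists_congr fun f => and_congr_right fun _ => and_congr_left fun _ => ?_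
  exact eventually_congr (h.mono fun ω hω => by rw [hω])

theorem convex_aumannIntegral {Ω : Type*} [MeasurableSpace Ω] {μ : Measure Ω} {n : ℕ}
    {F : Ω → Set (EuclideanSpace ℝ (Fin n))} (hF : ∀ᵐ ω ∂μ, Convex ℝ (F ω)) :
    Convex ℝ (aumannIntegral μ F) := by
  rintro _ ⟨f, hf, hfF, rfl⟩ _ ⟨g, hg, hgF, rfl⟩ a b ha hb hab
  refine ⟨fun ω => a • f ω + b • g ω, (hf.smul a).add (hg.smul b), ?_, ?_⟩
  · filter_upwards [hF, hfF, hgF] with ω h h1 h2 using h h1 h2 ha hb hab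
  · rw [← integral_smul, ← integral_smul]
    exact integral_add (hf.smul a) (hg.smul b)

theorem isConeSet_aumannIntegral {Ω : Type*} [MeasurableSpace Ω] {μ : Measure Ω} {n : ℕ}
    {F : Ω → Set (EuclideanSpace ℝ (Fin n))} (hF : ∀ ω, IsConeSet (F ω)) :
    IsConeSet (aumannIntegral μ F) := by
  refine ⟨⟨0, integrable_zero _ _ _, Eventually.of_forall fun ω => (hF ω).1, by simp⟩, ?_⟩
  rintro t ht _ ⟨f, hf, hfF, rfl⟩
  exact ⟨fun ω => t • f ω, hf.smul t, hfF.mono fun ω h => (hF ω).2 t ht _ h, integral_smul _ _⟩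

theorem aumannIntegral_polarCone_subset {Ω : Type*} [MeasurableSpace Ω] {μ : Measure Ω} {n : ℕ}
    {M : Ω → Set (EuclideanSpace ℝ (Fin n))} :
    aumannIntegral μ (fun ω => polarCone (M ω)) ⊆ polarCone (essInter μ M) := by
  rintro _ ⟨f, hf, hfF, rfl⟩ y hy
  have hy : ∀ᵐ ω ∂μ, y ∈ M ω := hy
  rw [real_inner_comm, ← integral_inner hf]
  refine integral_nonpos_of_ae ?_
  filter_upwards [hfF, hy] with ω h1 h2
  rw [real_inner_comm]
  exact h1 y h2

theorem polarCone_aumannIntegral_subset {Ω : Type*} [MeasurableSpace Ω] {μ : Measure Ω}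
    [SigmaFinite μ] {n : ℕ} {M : Ω → Set (EuclideanSpace ℝ (Fin n))}
    (hM : MeasurableMultifunction M) (hclosed : ∀ ω, IsClosed (M ω))
    (hcone : ∀ ω, IsConeSet (M ω)) (hreg : ∀ᵐ ω ∂μ, NormallyRegularAt (M ω) 0) :
    polarCone (aumannIntegral μ fun ω => polarCone (M ω)) ⊆ essInter μ M := by
  intro x hx
  have hex : ∀ ω, ∃ p, NormallyRegularAt (M ω) 0 → p ∈ M ω ∧
      Metric.infDist x (M ω) = ‖x - p‖ ∧ x - p ∈ polarCone (M ω) ∧ ⟪x - p, p⟫_ℝ = 0 := by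
    intro ω
    by_cases h : NormallyRegularAt (M ω) 0
    · obtain ⟨p, hp⟩ := (hcone ω).exists_moreau (hclosed ω) h x
      exact ⟨p, fun _ => hp⟩
    · exact ⟨0, fun h' => absurd h' h⟩
  choose p hp using hex
  have hpae := hreg.mono hp
  have hmeas := aestronglyMeasurable_residual hM hclosed hcone hreg x hpae
  -- The residuals are only bounded and `μ` may be infinite; a positive integrable weight makes them
  -- integrable and keeps them in the polar cones.
  obtain ⟨φ, hφpos, hφm, hφint⟩ := exists_pos_lintegral_lt_of_sigmaFinite μ one_ne_zero
  have hφi : Integrable (fun ω => (φ ω : ℝ)) μ := by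
    refine ⟨hφm.coe_nnreal_real.aestronglyMeasurable, ?_⟩
    rw [hasFiniteIntegral_iff_enorm]
    simpa using hφint.trans ENNReal.one_lt_top
  have hbound : ∀ᵐ ω ∂μ, ‖x - p ω‖ ≤ ‖x‖ := by
    filter_upwards [hpae] with ω ⟨_, h2, _, _⟩
    rw [← h2]
    simpa using Metric.infDist_le_dist_of_mem (x := x) (hcone ω).1
  have hfi : Integrable (fun ω => (φ ω : ℝ) • (x - p ω)) μ := hφi.smul_bdd _ hmeas hbound
  have hmem : ∫ ω, (φ ω : ℝ) • (x - p ω) ∂μ ∈ aumannIntegral μ fun ω => polarCone (M ω) := by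
    refine ⟨_, hfi, ?_, rfl⟩
    filter_upwards [hpae] with ω ⟨_, _, h3, _⟩
    exact (isConeSet_polarCone _).2 _ (hφpos ω) _ h3
  have hle := hx _ hmem
  rw [← integral_inner hfi] at hle
  have heq : (fun ω => ⟪x, (φ ω : ℝ) • (x - p ω)⟫_ℝ) =ᵐ[μ]
      fun ω => (φ ω : ℝ) * ‖x - p ω‖ ^ 2 := by
    filter_upwards [hpae] with ω ⟨_, _, _, h4⟩
    rw [inner_smul_right, ← real_inner_self_eq_norm_sq, inner_sub_left x (p ω) (x - p ω),
      real_inner_comm _ (p ω), h4, sub_zero]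
  have hint : Integrable (fun ω => (φ ω : ℝ) * ‖x - p ω‖ ^ 2) μ :=
    (hfi.const_inner x).congr heq
  rw [integral_congr_ae heq] at hle
  have hnonneg : 0 ≤ fun ω => (φ ω : ℝ) * ‖x - p ω‖ ^ 2 := fun ω => by positivity
  have hzero := (integral_eq_zero_iff_of_nonneg hnonneg hint).1
    (le_antisymm hle (integral_nonneg hnonneg))
  filter_upwards [hzero, hpae] with ω h0 ⟨h1, _, _, _⟩
  have : (φ ω : ℝ) ≠ 0 := by exact_mod_cast (hφpos ω).ne'
  have h5 : x - p ω = 0 := by simpa [this] using h0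
  rw [sub_eq_zero.1 h5]
  exact h1

/-! ### Bipolar theorem and relative interiors -/

/-- The bipolar theorem. -/
theorem IsConeSet.polarCone_polarCone_subset {n : ℕ} {A : Set (EuclideanSpace ℝ (Fin n))}
    (hA : IsConeSet A) (hconv : Convex ℝ A) : polarCone (polarCone A) ⊆ closure A := by
  intro v hv
  by_contra hvA
  obtain ⟨f, u, hf, hu⟩ := geometric_hahn_banach_closed_point hconv.closure isClosed_closure hvA
  have hfx : ∀ z, f z = ⟪(InnerProductSpace.toDual ℝ _).symm f, z⟫_ℝ := fun z => by simp
  have hu0 : 0 < u := by simpa using hf 0 (subset_closure hA.1)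
  have hx : (InnerProductSpace.toDual ℝ _).symm f ∈ polarCone A := by
    intro a ha
    rw [← hfx]
    by_contra! hpos
    -- The factor `u / f a` puts the scaled point on the hyperplane `f = u`.
    have h := hf _ (subset_closure (hA.2 (u / f a) (by positivity) a ha))
    rw [map_smul, smul_eq_mul, div_mul_cancel₀ _ hpos.ne'] at h
    exact lt_irrefl _ h
  have h := hv _ hx
  rw [real_inner_comm, ← hfx] at h
  linarith

theorem intrinsicInterior_eq_interior_of_affineSpan_eq_top {E : Type*} [NormedAddCommGroup E]
    [NormedSpace ℝ E] {A : Set E} (h : affineSpan ℝ A = ⊤) :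
    intrinsicInterior ℝ A = interior A := by
  have hopen : IsOpen (affineSpan ℝ A : Set E) := by simp [h]
  have hint : interior ((↑) ⁻¹' A : Set (affineSpan ℝ A)) = (↑) ⁻¹' interior A :=
    (hopen.isOpenMap_subtype_val.preimage_interior_eq_interior_preimage
      continuous_subtype_val A).symm
  rw [intrinsicInterior, hint]
  exact Subtype.image_preimage_coe _ _ |>.trans
    (Set.inter_eq_right.2 (interior_subset.trans (subset_affineSpan ℝ A)))

/-- A convex subset of a finite-dimensional space has the same relative interior as its closure. -/
theorem Convex.intrinsicInterior_closure {E : Type*} [NormedAddCommGroup E] [NormedSpace ℝ E]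
    [FiniteDimensional ℝ E] {A : Set E} (hA : Convex ℝ A) (h0 : (0 : E) ∈ A) :
    intrinsicInterior ℝ (closure A) = intrinsicInterior ℝ A := by
  -- Inside its own span the set has nonempty interior, and relative interiors become interiors.
  set S := Submodule.span ℝ A
  let ι := S.subtypeₗᵢ.toAffineIsometry
  let B : Set S := (fun s : S => (s : E)) ⁻¹' A
  have hBA : ι '' B = A := by
    ext x
    refine ⟨?_, fun hx => ⟨⟨x, Submodule.subset_span hx⟩, hx, rfl⟩⟩
    rintro ⟨y, hy, rfl⟩
    exact hy
  have hBconv : Convex ℝ B := hA.linear_preimage S.subtype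
  have hspan : affineSpan ℝ B = ⊤ := by
    have hB0 : (0 : S) ∈ B := h0
    rw [← AffineSubspace.coe_eq_univ_iff, ← Set.insert_eq_of_mem hB0, affineSpan_insert_zero,
      Submodule.span_span_coe_preimage, Submodule.top_coe]
  have hBint : (interior B).Nonempty := hBconv.interior_nonempty_iff_affineSpan_eq_top.2 hspan
  have hclosed : IsClosedEmbedding (fun s : S => (s : E)) :=
    S.closed_of_finiteDimensional.isClosedEmbedding_subtypeVal
  have hcl : ι '' closure B = closure A := by
    rw [← hBA]
    exact (hclosed.closure_image_eq B).symm
  have hspan' : affineSpan ℝ (closure B) = ⊤ :=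
    top_unique (hspan.symm.le.trans (affineSpan_mono ℝ subset_closure))
  rw [← hcl, ← hBA, ι.intrinsicInterior_image, ι.intrinsicInterior_image,
    intrinsicInterior_eq_interior_of_affineSpan_eq_top hspan',
    intrinsicInterior_eq_interior_of_affineSpan_eq_top hspan,
    hBconv.interior_closure_eq_interior_of_nonempty_interior hBint]

theorem corollary4p3 {Ω : Type*} [MeasurableSpace Ω] (μ : Measure Ω)
    [SigmaFinite μ] [μ.IsComplete] (hμ : 0 < μ Set.univ) (n : ℕ)
    (M : Ω → Set (EuclideanSpace ℝ (Fin n)))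
    (hM : MeasurableMultifunction M)
    (hclosed : ∀ ω, IsClosed (M ω))
    (hcone : ∀ ω, IsConeSet (M ω))
    (hreg : ∀ᵐ ω ∂μ, NormallyRegularAt (M ω) 0) :
    NormallyRegularAt (essInter μ M) 0 ∧
    limitingNormalCone 0 (essInter μ M) =
      closure (aumannIntegral μ fun ω => limitingNormalCone 0 (M ω)) ∧
    intrinsicInterior ℝ (limitingNormalCone 0 (essInter μ M)) =
      intrinsicInterior ℝ (aumannIntegral μ fun ω => limitingNormalCone 0 (M ω)) := by

  have hK : IsConeSet (essInter μ M) := isConeSet_essInter hcone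
  have hconv : Convex ℝ (essInter μ M) := convex_essInter <| hreg.mono fun ω h =>
    (hcone ω).convex_of_normallyRegularAt (hclosed ω) h
  have hlim := hK.limitingNormalCone_zero_of_convex hconv
  have hint : aumannIntegral μ (fun ω => limitingNormalCone 0 (M ω)) =
      aumannIntegral μ fun ω => polarCone (M ω) :=
    aumannIntegral_congr_ae <| hreg.mono fun ω h =>
      (hcone ω).limitingNormalCone_zero_of_regular h
  have hAcone : IsConeSet (aumannIntegral μ fun ω => polarCone (M ω)) :=
    isConeSet_aumannIntegral fun ω => isConeSet_polarCone _
  have hAconv : Convex ℝ (aumannIntegral μ fun ω => polarCone (M ω)) :=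
    convex_aumannIntegral <| Eventually.of_forall fun ω => convex_polarCone _
  have hcl : polarCone (essInter μ M) = closure (aumannIntegral μ fun ω => polarCone (M ω)) := by
    refine Set.Subset.antisymm (fun v hv => hAcone.polarCone_polarCone_subset hAconv fun x hx =>
      hv x (polarCone_aumannIntegral_subset hM hclosed hcone hreg hx)) ?_
    exact closure_minimal aumannIntegral_polarCone_subset (isClosed_polarCone _)
  rw [hlim, hint]
  refine ⟨⟨hK.1, by rw [hK.regularNormalCone_zero, hlim]⟩, hcl, ?_⟩
  rw [hcl, hAconv.intrinsicInterior_closure hAcone.1]
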